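/- For a probability measure $\mu$ on $\mathbb R$ let $G_\mu(z)=\int_{\mathbb R}\frac{\mu(dx)}{z-x}$, $F_\mu=1/G_\mu$, and let $\varphi_\mu(z)=F_\mu^{-1}(z)-z$ be its Voiculescu transform, where $F_\mu^{-1}$ is the right inverse of $F_\mu$ near $\infty$: $F_\mu$ is one-to-one on $\{|z|>R\}$ for some $R$, $F_\mu(F_\mu^{-1}(z))=z$ for $|z|$ large, and $F_\mu^{-1}(z)\to\infty$ as $z\to\infty$. For $a\in\mathbb R$ and $b\ge -1$, a probability measure $\mu$ with finite moments of all orders is called a standard free Meixner distribution with parameters $a,b$ if its Jacobi–Szegő parameters are $\alpha_0=0$, $\alpha_n=a$ $(n\ge 1)$, $\omega_1=1$, $\omega_n=1+b$ $(n\ge 2)$; that is, the monic polynomials given by $P_0=1$, $P_1=x-\alpha_0$, $P_{n+1}=(x-\alpha_n)P_n-\omega_nP_{n-1}$ $(n\ge1)$ are orthogonal in $L^2(\mu)$. For $b\ge0$ let $\omega_{a,b}$ be the semicircle law of mean $a$ and variance $b$, i.e. the law with density $\frac{1}{2\pi b}\sqrt{4b-(x-a)^2}$ on $[a-2\sqrt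 b,a+2\sqrt b]$ if $b>0$, and $\omega_{a,0}=\delta_a$. Let $\mu$ be a standard free Meixner distribution with parameters $a\in\mathbb R$ and $b\ge-1$. (i) If $b\ge 0$, then the Voiculescu transform of $\mu$ is well defined near $\infty$ and $\varphi_\mu(y)=G_{\omega_{a,b}}(y)$ for all $y\in\mathbb C$ in some neighbourhood of $\infty$. (ii) If $-1\le b<0$, put $g(z)=\dfrac{z}{1+az+bz^2}$. Then a standard free Meixner distribution $\eta$ with parameters $a$ and $1+b$ exists, and for every such $\eta$ the Voiculescu transform $\varphi_\eta$ is well defined near $\infty$ and, for all $z\in\mathbb C$ in some neighbourhood of $\infty$, $\varphi_\eta(z)=G_{\omega_{a,1+b}}(z)$, $1+a\varphi_\eta(z)+b\varphi_\eta(z)^2\neq0$ and $$G_\mu(z)=g\bigl(\varphi_\eta(z)\bigr).$$ -/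

import Mathlib

open MeasureTheory Filter Bornology Polynomial

noncomputable section

/-- The Cauchy-Stieltjes transform `G_μ(z) = ∫ 1 / (z - x) μ(dx)`, meaningful for `z` outside the
support of `μ`. -/
def cauchyTransform (μ : Measure ℝ) (z : ℂ) : ℂ :=
  ∫ x : ℝ, 1 / (z - (x : ℂ)) ∂μ

/-- The reciprocal Cauchy transform `F_μ = 1 / G_μ`. -/
def reciprocalCauchyTransform (μ : Measure ℝ) (z : ℂ) : ℂ :=
  1 / cauchyTransform μ z

/-- `F` is one-to-one in a neighbourhood of infinity in `ℂ` and `H` is its right inverse there: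
`H(z) → ∞` as `z → ∞`, and `F(H(z)) = z` for all `z` of sufficiently large modulus.
The germ of `H` at infinity is then determined by `F`. -/
structure IsInverseNearInfinity (F H : ℂ → ℂ) : Prop where
  injOn : ∃ R : ℝ, Set.InjOn F {w : ℂ | R < ‖w‖}
  tendsto : Tendsto H (cobounded ℂ) (cobounded ℂ)
  rightInverse : ∀ᶠ z in cobounded ℂ, F (H z) = z

/-- Two right inverses of `F` near infinity agree near infinity. -/
theorem IsInverseNearInfinity.eventuallyEq {F H K : ℂ → ℂ} (hH : IsInverseNearInfinity F H)
    (hK : IsInverseNearInfinity F K) : H =ᶠ[cobounded ℂ] K := by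
  obtain ⟨R, hR⟩ := hH.injOn
  have hbig : ∀ᶠ w in cobounded ℂ, R < ‖w‖ :=
    (tendsto_norm_cobounded_atTop (E := ℂ)).eventually (eventually_gt_atTop R)
  filter_upwards [hH.tendsto.eventually hbig, hK.tendsto.eventually hbig, hH.rightInverse,
    hK.rightInverse] with z h1 h2 h3 h4
  exact hR h1 h2 (h3.trans h4.symm)

/-- The right inverse of `F` near infinity, if there is one. -/
def inverseNearInfinity (F : ℂ → ℂ) : ℂ → ℂ :=
  Classical.epsilon (IsInverseNearInfinity F)

/-- The Voiculescu transform `φ_μ(z) = F_μ⁻¹(z) - z` of a compactly supported probability measure,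
defined for `z` in a neighbourhood of infinity. -/
def voiculescuTransform (μ : Measure ℝ) (z : ℂ) : ℂ :=
  inverseNearInfinity (reciprocalCauchyTransform μ) z - z

/-- The monic polynomials with `P 0 = 1`, `P 1 = X - α 0` and
`X * P n = P (n + 1) + α n * P n + ω n * P (n - 1)` for `n ≥ 1`; the value `ω 0` is not used. -/
def jacobiSzegoPolynomial (α ω : ℕ → ℝ) : ℕ → ℝ[X]
  | 0 => 1
  | 1 => X - C (α 0)
  | n + 2 => (X - C (α (n + 1))) * jacobiSzegoPolynomial α ω (n + 1)
      - C (ω (n + 1)) * jacobiSzegoPolynomial α ω n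

/-- The probability measure `μ` has finite moments of all orders and Jacobi-Szegő parameters
`(α n)` for `n ≥ 0`, `(ω n)` for `n ≥ 1`: the monic polynomials that they define recursively are
orthogonal in `L²(μ)`. -/
structure HasJacobiSzegoParameters (μ : Measure ℝ) (α ω : ℕ → ℝ) : Prop where
  isProbabilityMeasure : IsProbabilityMeasure μ
  integrable_pow : ∀ n : ℕ, Integrable (fun x : ℝ => x ^ n) μ
  orthogonal : ∀ m n : ℕ, m ≠ n →
    ∫ x : ℝ, (jacobiSzegoPolynomial α ω m).eval x * (jacobiSzegoPolynomial α ω n).eval x ∂μ = 0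

/-- `μ` is a standard free Meixner distribution with parameters `a ∈ ℝ`, `b ≥ -1`: its
Jacobi-Szegő parameters are `α 0 = 0`, `α n = a` for `n ≥ 1`, `ω 1 = 1`, `ω n = 1 + b` for
`n ≥ 2`. In particular it has mean zero and variance one. -/
structure IsFreeMeixner (a b : ℝ) (μ : Measure ℝ) : Prop where
  neg_one_le : -1 ≤ b
  hasParameters : HasJacobiSzegoParameters μ
    (fun n => if n = 0 then 0 else a) (fun n => if n ≤ 1 then 1 else 1 + b)

/-- The semicircle law `ω_{a,b}` of mean `a` and variance `b ≥ 0`, which is the Dirac mass at `a`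
for `b = 0`. The square root vanishes outside `[a - 2√b, a + 2√b]`. -/
def semicircleLaw (a b : ℝ) : Measure ℝ :=
  if b = 0 then Measure.dirac a
  else volume.withDensity fun x : ℝ =>
    ENNReal.ofReal (Real.sqrt (4 * b - (x - a) ^ 2) / (2 * Real.pi * b))

/-- The rational function `g(z) = z / (1 + a z + b z²)`. -/
def meixnerRational (a b : ℝ) (z : ℂ) : ℂ :=
  z / (1 + (a : ℂ) * z + (b : ℂ) * z ^ 2)

end

/-! Everything becomes rational in the coordinate `z = a + c w + 1/w`, with `w` near `0` and `z`
near infinity. If the parameters equal `a, c` except for `α 0` and `ω 1`, then `∑ P_n(x) w^n` is an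
explicit polynomial in `w` divided by `1 - (x - a) w + c w² = w (z - x)`. Integration kills all
terms with `n ≥ 1`, which gives `G(z) = w / (1 + (a - α 0) w + (c - ω 1) w²)`
(`cauchyTransform_of_integral_jacobiSzegoPolynomial`).

For the semicircle law `ω_{a,b}` this says `G(a + b w + 1/w) = w`; for the Meixner law `μ` it says
`F_μ(a + (1 + b) w + 1/w) = a + b w + 1/w`. Hence with `y = a + b w + 1/w` the inverse of `F_μ`
takes `y` to `y + w = y + G_{ω_{a,b}}(y)`, which is (i). For (ii), the formula for `G_μ` reads
`G_μ(z) = g(w)` with `w = G_{ω_{a,1+b}}(z)`, and (i) identifies this `w` with `φ_η(z)`. The law `η`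
exists as a spectral measure of a bounded Jacobi operator. -/

/-! ### Bounded Jacobi-Szegő parameters: growth bounds and compact support -/

theorem jacobiSzegoPolynomial_add_two (α ω : ℕ → ℝ) (n : ℕ) :
    jacobiSzegoPolynomial α ω (n + 2) =
      (X - C (α (n + 1))) * jacobiSzegoPolynomial α ω (n + 1)
        - C (ω (n + 1)) * jacobiSzegoPolynomial α ω n := by
  rw [jacobiSzegoPolynomial]

/-- A crude geometric bound, enough for the generating function to converge for small `w`, uniformly
on a compact support. -/
theorem abs_eval_jacobiSzegoPolynomial_le {α ω : ℕ → ℝ} {M K x : ℝ} (hα : ∀ n, |α n| ≤ M)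
    (hω : ∀ n, |ω n| ≤ M) (hx : |x| ≤ K) (n : ℕ) :
    |(jacobiSzegoPolynomial α ω n).eval x| ≤ (K + 2 * M + 1) ^ n := by
  have hM : 0 ≤ M := (abs_nonneg _).trans (hα 0)
  have hK : 0 ≤ K := (abs_nonneg _).trans hx
  have hsub (n : ℕ) : |x - α n| ≤ K + M :=
    (abs_sub _ _).trans (add_le_add hx (hα n))
  induction n using Nat.twoStepInduction with
  | zero => simp [jacobiSzegoPolynomial]
  | one =>
    simp only [jacobiSzegoPolynomial, eval_sub, eval_X, eval_C, pow_one]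
    linarith [hsub 0]
  | more n h0 h1 =>
    rw [jacobiSzegoPolynomial_add_two]
    simp only [eval_sub, eval_mul, eval_X, eval_C]
    set D := K + 2 * M + 1 with hD
    have hDn : D ^ n ≤ D ^ (n + 1) := pow_le_pow_right₀ (by linarith) (Nat.le_succ n)
    have hpos : 0 ≤ D ^ (n + 1) := by positivity
    calc _ ≤ |x - α (n + 1)| * |(jacobiSzegoPolynomial α ω (n + 1)).eval x|
          + |ω (n + 1)| * |(jacobiSzegoPolynomial α ω n).eval x| := by
            rw [← abs_mul, ← abs_mul]; exact abs_sub _ _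
      _ ≤ (K + M) * D ^ (n + 1) + M * D ^ (n + 1) := by
            gcongr
            · exact hsub _
            · exact hω _
            · exact h0.trans hDn
      _ ≤ D * D ^ (n + 1) := by
            rw [← add_mul]; gcongr; linarith
      _ = D ^ (n + 2) := by ring

namespace HasJacobiSzegoParameters

variable {μ : Measure ℝ} {α ω : ℕ → ℝ}

theorem integrable_eval (h : HasJacobiSzegoParameters μ α ω) (p : ℝ[X]) :
    Integrable (fun x => p.eval x) μ := by
  simp only [eval_eq_sum_range]
  exact integrable_finsetSum _ fun i _ => (h.integrable_pow i).const_mul _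

theorem integral_eval_jacobiSzegoPolynomial (h : HasJacobiSzegoParameters μ α ω) {n : ℕ}
    (hn : n ≠ 0) : ∫ x, (jacobiSzegoPolynomial α ω n).eval x ∂μ = 0 := by
  simpa [jacobiSzegoPolynomial] using h.orthogonal n 0 hn

/-- Multiplication by `x` turns `P_k` into a combination of its neighbours with coefficients `1, α
k, ω k`, of total size at most `1 + 2M`. The induction on `n` needs all `k` at once; the case `k =
0` bounds the moments. -/
theorem abs_integral_pow_mul_le (h : HasJacobiSzegoParameters μ α ω) {M : ℝ}
    (hα : ∀ n, |α n| ≤ M) (hω : ∀ n, |ω n| ≤ M) (n k : ℕ) :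
    |∫ x, x ^ n * (jacobiSzegoPolynomial α ω k).eval x ∂μ| ≤ (1 + 2 * M) ^ n := by
  have := h.isProbabilityMeasure
  have hM : 0 ≤ M := (abs_nonneg _).trans (hα 0)
  have hint (n : ℕ) (p : ℝ[X]) : Integrable (fun x => x ^ n * p.eval x) μ :=
    (h.integrable_eval (X ^ n * p)).congr (Eventually.of_forall fun x => by simp)
  induction n generalizing k with
  | zero =>
    rcases eq_or_ne k 0 with rfl | hk
    · simp [jacobiSzegoPolynomial]
    · simp [h.integral_eval_jacobiSzegoPolynomial hk]
  | succ n ih =>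
    have hpos : 0 ≤ (1 + 2 * M) ^ n := by positivity
    rcases k with _ | k
    · have hx (x : ℝ) : x ^ (n + 1) * (jacobiSzegoPolynomial α ω 0).eval x =
          x ^ n * (jacobiSzegoPolynomial α ω 1).eval x
            + α 0 * (x ^ n * (jacobiSzegoPolynomial α ω 0).eval x) := by
        simp [jacobiSzegoPolynomial]; ring
      simp only [hx]
      rw [integral_add (hint _ _) ((hint _ _).const_mul _), integral_const_mul]
      calc _ ≤ _ := abs_add_le _ _
        _ ≤ (1 + 2 * M) ^ n + M * (1 + 2 * M) ^ n := by
          rw [abs_mul]; gcongr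
          · exact ih _
          · exact hα _
          · exact ih _
        _ ≤ _ := by rw [pow_succ]; nlinarith
    · have hx (x : ℝ) : x ^ (n + 1) * (jacobiSzegoPolynomial α ω (k + 1)).eval x =
          x ^ n * (jacobiSzegoPolynomial α ω (k + 2)).eval x
            + α (k + 1) * (x ^ n * (jacobiSzegoPolynomial α ω (k + 1)).eval x)
            + ω (k + 1) * (x ^ n * (jacobiSzegoPolynomial α ω k).eval x) := by
        rw [jacobiSzegoPolynomial_add_two]
        simp only [eval_sub, eval_mul, eval_X, eval_C]; ring
      simp only [hx]
      rw [integral_add (by exact (hint _ _).add ((hint _ _).const_mul _)) ((hint _ _).const_mul _),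
        integral_add (hint _ _) ((hint _ _).const_mul _), integral_const_mul, integral_const_mul]
      calc _ ≤ _ := abs_add_three _ _ _
        _ ≤ (1 + 2 * M) ^ n + M * (1 + 2 * M) ^ n + M * (1 + 2 * M) ^ n := by
          rw [abs_mul, abs_mul]; gcongr
          · exact ih _
          · exact hα _
          · exact ih _
          · exact hω _
          · exact ih _
        _ = _ := by ring

/-- A measure with bounded Jacobi-Szegő parameters has compact support. -/
theorem ae_abs_le (h : HasJacobiSzegoParameters μ α ω) {M : ℝ}
    (hα : ∀ n, |α n| ≤ M) (hω : ∀ n, |ω n| ≤ M) : ∀ᵐ x ∂μ, |x| ≤ 2 * (1 + 2 * M) := by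
  have := h.isProbabilityMeasure
  have hM : 0 ≤ M := (abs_nonneg _).trans (hα 0)
  set K := 1 + 2 * M with hK
  have hKpos : 0 < K := by linarith
  -- Markov's inequality for the moment of order `2n`, which is at most `K^(2n)`.
  have key (n : ℕ) : μ.real {x | 2 * K ≤ |x|} ≤ (1 / 4 : ℝ) ^ n := by
    have h1 : (2 * K) ^ (2 * n) * μ.real {x | (2 * K) ^ (2 * n) ≤ x ^ (2 * n)} ≤
        ∫ x, x ^ (2 * n) ∂μ :=
      mul_meas_ge_le_integral_of_nonneg
        (Eventually.of_forall fun x => (even_two_mul n).pow_nonneg x) (h.integrable_pow _) _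
    have h2 : ∫ x, x ^ (2 * n) ∂μ ≤ K ^ (2 * n) := by
      simpa [jacobiSzegoPolynomial] using
        (le_abs_self _).trans (h.abs_integral_pow_mul_le hα hω (2 * n) 0)
    have h3 : μ.real {x | 2 * K ≤ |x|} ≤ μ.real {x | (2 * K) ^ (2 * n) ≤ x ^ (2 * n)} := by
      refine measureReal_mono fun x hx => ?_
      rw [Set.mem_ofPred_eq, ← (even_two_mul n).pow_abs x]
      exact pow_le_pow_left₀ (by positivity) hx _
    refine h3.trans ?_
    have h4 : (1 / 4 : ℝ) ^ n = K ^ (2 * n) / (2 * K) ^ (2 * n) := by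
      rw [pow_mul, pow_mul, ← div_pow]
      congr 1
      field_simp
      norm_num
    rw [h4, le_div_iff₀' (by positivity)]
    exact h1.trans h2
  have hz : μ.real {x | 2 * K ≤ |x|} = 0 :=
    le_antisymm (ge_of_tendsto' (tendsto_pow_atTop_nhds_zero_of_lt_one (by norm_num) (by norm_num))
      key) measureReal_nonneg
  rw [measureReal_eq_zero_iff] at hz
  filter_upwards [measure_eq_zero_iff_ae_notMem.mp hz] with x hx
  exact (not_le.mp hx).le

end HasJacobiSzegoParameters

/-! ### Generating function and Cauchy transform -/

/-- The generating function of polynomials whose Jacobi-Szegő parameters are eventually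
constant. -/
theorem tsum_jacobiSzegoPolynomial_mul {α ω : ℕ → ℝ} {a c M K x : ℝ} (hα : ∀ n, |α n| ≤ M)
    (hω : ∀ n, |ω n| ≤ M) (hα' : ∀ n, α (n + 1) = a) (hω' : ∀ n, ω (n + 2) = c) (hx : |x| ≤ K)
    {w : ℂ} (hw : (K + 2 * M + 1) * ‖w‖ < 1) :
    (∑' n, (((jacobiSzegoPolynomial α ω n).eval x : ℝ) : ℂ) * w ^ n) * (1 - (x - a) * w + c * w ^ 2) =
      1 + (a - α 0) * w + (c - ω 1) * w ^ 2 := by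
  have hM : 0 ≤ M := (abs_nonneg _).trans (hα 0)
  have hK : 0 ≤ K := (abs_nonneg _).trans hx
  set f : ℕ → ℂ := fun n => (((jacobiSzegoPolynomial α ω n).eval x : ℝ) : ℂ) * w ^ n with hf
  have hs : Summable f := by
    refine Summable.of_norm_bounded (summable_geometric_of_lt_one (by positivity) hw) fun n => ?_
    rw [norm_mul, norm_pow, Complex.norm_real, mul_pow]
    gcongr
    exact abs_eval_jacobiSzegoPolynomial_le hα hω hx n
  -- The recurrence has constant coefficients only from `P_3` on, since `P_2` involves the
  -- exceptional `ω 1` and `P_1` involves `α 0`. The first three terms produce the numerator.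
  have hrec (n : ℕ) : f (n + 3) = (x - a) * w * f (n + 2) - c * w ^ 2 * f (n + 1) := by
    simp only [hf]
    rw [jacobiSzegoPolynomial_add_two, hα', hω']
    simp only [eval_sub, eval_mul, eval_X, eval_C]
    push_cast
    ring
  have hS (k : ℕ) : HasSum (fun n => f (n + k)) (∑' n, f n - ∑ i ∈ Finset.range k, f i) :=
    (hasSum_nat_add_iff' k).mpr hs.hasSum
  have h3 := (hS 3).unique
    (by simpa only [hrec] using
      ((hS 2).mul_left ((x - a) * w)).sub ((hS 1).mul_left (c * w ^ 2)))
  have f0 : f 0 = 1 := by simp [hf, jacobiSzegoPolynomial]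
  have f1 : f 1 = (x - α 0) * w := by simp [hf, jacobiSzegoPolynomial]
  have f2 : f 2 = ((x - a) * (x - α 0) - ω 1) * w ^ 2 := by
    simp [hf, jacobiSzegoPolynomial, hα']
  simp only [Finset.sum_range_succ, Finset.sum_range_zero, f0, f1, f2] at h3
  linear_combination h3

open Topology in
-- Termwise integration of the generating function gives `1`. Only orthogonality to `P_0` is
-- required, so the semicircle law can be treated without its full orthogonality relations.
theorem cauchyTransform_of_integral_jacobiSzegoPolynomial {μ : Measure ℝ} [IsProbabilityMeasure μ]
    {α ω : ℕ → ℝ} {a c M K : ℝ} (hα : ∀ n, |α n| ≤ M)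
    (hω : ∀ n, |ω n| ≤ M) (hα' : ∀ n, α (n + 1) = a) (hω' : ∀ n, ω (n + 2) = c)
    (hK : ∀ᵐ x ∂μ, |x| ≤ K)
    (hP : ∀ n, n ≠ 0 → ∫ x, (jacobiSzegoPolynomial α ω n).eval x ∂μ = 0) :
    ∀ᶠ w : ℂ in 𝓝[≠] 0, 1 + (a - α 0) * w + (c - ω 1) * w ^ 2 ≠ 0 ∧
      cauchyTransform μ (a + c * w + 1 / w) = w / (1 + (a - α 0) * w + (c - ω 1) * w ^ 2) := by
  have hM : 0 ≤ M := (abs_nonneg _).trans (hα 0)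
  have hK0 : 0 ≤ K := by
    obtain ⟨x, hx⟩ := hK.exists
    exact (abs_nonneg _).trans hx
  have e1 : ∀ᶠ w : ℂ in 𝓝 0, 1 + (a - α 0) * w + (c - ω 1) * w ^ 2 ≠ 0 :=
    ContinuousAt.eventually_ne (by fun_prop) (by simp)
  have e2 : ∀ᶠ w : ℂ in 𝓝 0, (K + 2 * M + 1) * ‖w‖ < 1 :=
    ContinuousAt.eventually_lt (by fun_prop) (by fun_prop) (by simp)
  filter_upwards [nhdsWithin_le_nhds e1, nhdsWithin_le_nhds e2, self_mem_nhdsWithin] with w h1 h2 h0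
  refine ⟨h1, ?_⟩
  replace h0 : w ≠ 0 := h0
  have hbound (n : ℕ) : ∀ᵐ x ∂μ, ‖(((jacobiSzegoPolynomial α ω n).eval x : ℝ) : ℂ) * w ^ n‖ ≤
      ((K + 2 * M + 1) * ‖w‖) ^ n := by
    filter_upwards [hK] with x hx
    rw [norm_mul, norm_pow, Complex.norm_real, mul_pow]
    gcongr
    exact abs_eval_jacobiSzegoPolynomial_le hα hω hx n
  have hint (n : ℕ) :
      Integrable (fun x => (((jacobiSzegoPolynomial α ω n).eval x : ℝ) : ℂ) * w ^ n) μ :=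
    Integrable.of_bound (by fun_prop) _ (hbound n)
  have hsum : Summable fun n =>
      ∫ x, ‖(((jacobiSzegoPolynomial α ω n).eval x : ℝ) : ℂ) * w ^ n‖ ∂μ := by
    refine Summable.of_nonneg_of_le (fun n => integral_nonneg fun x => norm_nonneg _) (fun n => ?_)
      (summable_geometric_of_lt_one (by positivity) h2)
    simpa using integral_mono_ae (hint n).norm (integrable_const _) (hbound n)
  have hS := hasSum_integral_of_summable_integral_norm hint hsum
  have hS1 : HasSum (fun n => ∫ x, (((jacobiSzegoPolynomial α ω n).eval x : ℝ) : ℂ) * w ^ n ∂μ) 1 := by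
    convert! hasSum_ite_eq 0 (1 : ℂ) using 2 with n
    split_ifs with hn
    · subst hn; simp [jacobiSzegoPolynomial]
    · rw [integral_mul_const, integral_complex_ofReal, hP n hn]; simp
  have h4 : (1 + (a - α 0) * w + (c - ω 1) * w ^ 2) / w * cauchyTransform μ (a + c * w + 1 / w)
      = 1 := by
    refine Eq.trans ?_ (hS.unique hS1)
    rw [cauchyTransform, ← integral_const_mul]
    refine integral_congr_ae ?_
    filter_upwards [hK] with x hx
    have h5 := tsum_jacobiSzegoPolynomial_mul hα hω hα' hω' hx h2
    rw [← h5]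
    have h6 : (1 - (x - a) * w + c * w ^ 2 : ℂ) ≠ 0 := by
      intro h; rw [h, mul_zero] at h5; exact h1 h5.symm
    have h7 : (a + c * w + 1 / w - x : ℂ) = (1 - (x - a) * w + c * w ^ 2) / w := by
      field_simp; ring
    rw [h7, one_div_div, div_mul_div_cancel₀ h0, mul_div_cancel_right₀ _ h6]
  rw [eq_div_iff h1]
  rw [div_mul_eq_mul_div, div_eq_one_iff_eq h0] at h4
  rw [mul_comm, h4]

/-! ### The semicircle law -/

theorem integral_semicircleLaw {a b : ℝ} (hb : 0 < b) {f : ℝ → ℝ} (hf : Continuous f) :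
    ∫ x, f x ∂semicircleLaw a b =
      2 / Real.pi * ∫ θ in (0)..Real.pi, f (a + 2 * √b * Real.cos θ) * Real.sin θ ^ 2 := by
  have hpi := Real.pi_pos
  have hsb : 0 < √b := Real.sqrt_pos.mpr hb
  have hsq : √b ^ 2 = b := Real.sq_sqrt hb.le
  set g : ℝ → ℝ := fun x => √(4 * b - (x - a) ^ 2) / (2 * Real.pi * b) * f x with hg
  have hgc : Continuous g := by fun_prop
  have h1 : ∫ x, f x ∂semicircleLaw a b = ∫ x, g x := by
    rw [semicircleLaw, if_neg hb.ne', integral_withDensity_eq_integral_toReal_smul (by fun_prop)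
      (by simp)]
    refine integral_congr_ae (Eventually.of_forall fun x => ?_)
    simp only [smul_eq_mul, hg]
    rw [ENNReal.toReal_ofReal (by positivity)]
  have h2 : ∫ x, g x = ∫ x in (a - 2 * √b)..(a + 2 * √b), g x := by
    rw [intervalIntegral.integral_of_le (by linarith), ← integral_Icc_eq_integral_Ioc,
      setIntegral_eq_integral_of_forall_compl_eq_zero]
    intro x hx
    have : 4 * b - (x - a) ^ 2 ≤ 0 := by
      rw [Set.mem_Icc, not_and_or, not_le, not_le] at hx
      rcases hx with hx | hx <;> nlinarith
    simp [hg, Real.sqrt_eq_zero_of_nonpos this]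
  have h3 := intervalIntegral.integral_comp_mul_deriv (a := 0) (b := Real.pi)
    (f := fun θ => a + 2 * √b * Real.cos θ) (f' := fun θ => 2 * √b * (-Real.sin θ)) (g := g)
    (fun θ _ => ((Real.hasDerivAt_cos θ).const_mul _).const_add _) (by fun_prop) hgc
  simp only [Real.cos_zero, Real.cos_pi, mul_one, mul_neg, ← sub_eq_add_neg] at h3
  rw [h1, h2, intervalIntegral.integral_symm, ← h3, ← intervalIntegral.integral_const_mul,
    ← intervalIntegral.integral_neg]
  refine intervalIntegral.integral_congr fun θ hθ => ?_
  rw [Set.uIcc_of_le hpi.le] at hθ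
  have hsin := Real.sin_nonneg_of_mem_Icc hθ
  have h4 : √(4 * b - (a + 2 * √b * Real.cos θ - a) ^ 2) = 2 * √b * Real.sin θ := by
    have h5 : 4 * b - (a + 2 * √b * Real.cos θ - a) ^ 2 = (2 * √b * Real.sin θ) ^ 2 := by
      linear_combination -4 * hsq - 4 * √b ^ 2 * Real.sin_sq_add_cos_sq θ
    rw [h5, Real.sqrt_sq (by positivity)]
  simp only [Function.comp_apply, hg, h4]
  field_simp
  rw [hsq]
  ring

theorem isProbabilityMeasure_semicircleLaw {a b : ℝ} (hb : 0 ≤ b) :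
    IsProbabilityMeasure (semicircleLaw a b) := by
  rcases hb.eq_or_lt with rfl | hb
  · rw [semicircleLaw, if_pos rfl]; infer_instance
  · have h := integral_semicircleLaw (a := a) hb (continuous_const (y := (1 : ℝ)))
    simp only [integral_const, one_mul, integral_sin_sq, smul_eq_mul, mul_one] at h
    have h1 : (semicircleLaw a b).real Set.univ = 1 := by
      rw [h]; have := Real.pi_pos; simp
    exact ⟨by rwa [measureReal_def, ENNReal.toReal_eq_one_iff] at h1⟩

theorem ae_semicircleLaw {a b : ℝ} (hb : 0 ≤ b) :
    ∀ᵐ x ∂semicircleLaw a b, |x| ≤ |a| + 2 * √b := by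
  rw [semicircleLaw]
  split_ifs with h
  · rw [ae_dirac_eq]
    simp
  · rw [ae_withDensity_iff (by fun_prop)]
    refine Eventually.of_forall fun x hx => ?_
    rw [ne_eq, ENNReal.ofReal_eq_zero, not_le] at hx
    have h1 : 0 < 4 * b - (x - a) ^ 2 := by
      by_contra! h2
      simp [Real.sqrt_eq_zero_of_nonpos h2] at hx
    have h2 : |x - a| ≤ 2 * √b := by
      refine abs_le_of_sq_le_sq ?_ (by positivity)
      rw [mul_pow, Real.sq_sqrt hb]
      linarith
    calc |x| = |a + (x - a)| := by ring_nf
      _ ≤ |a| + |x - a| := abs_add_le _ _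
      _ ≤ _ := by gcongr

/-- With constant parameters the polynomials are rescaled Chebyshev polynomials of the second kind;
the factor `sin θ` avoids a division. -/
theorem eval_jacobiSzegoPolynomial_const_mul_sin {a b : ℝ} (hb : 0 ≤ b) (θ : ℝ) (n : ℕ) :
    (jacobiSzegoPolynomial (fun _ => a) (fun _ => b) n).eval (a + 2 * √b * Real.cos θ) * Real.sin θ
      = √b ^ n * Real.sin ((n + 1) * θ) := by
  induction n using Nat.twoStepInduction with
  | zero => simp [jacobiSzegoPolynomial]
  | one =>
    simp only [jacobiSzegoPolynomial, eval_sub, eval_X, eval_C]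
    norm_num
    rw [Real.sin_two_mul]
    ring
  | more n h0 h1 =>
    rw [jacobiSzegoPolynomial_add_two]
    simp only [eval_sub, eval_mul, eval_X, eval_C]
    have h2 : Real.sin ((n + 3) * θ) + Real.sin ((n + 1) * θ) =
        2 * Real.sin ((n + 2) * θ) * Real.cos θ := by
      rw [show ((n : ℝ) + 3) * θ = (n + 2) * θ + θ by ring,
        show ((n : ℝ) + 1) * θ = (n + 2) * θ - θ by ring, Real.sin_add, Real.sin_sub]
      ring
    have h3 : b = √b ^ 2 := (Real.sq_sqrt hb).symm
    push_cast at h1 ⊢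
    rw [show (n : ℝ) + 1 + 1 = n + 2 by ring] at h1
    rw [show (n : ℝ) + 2 + 1 = n + 3 by ring]
    calc _ = 2 * √b * Real.cos θ * (eval (a + 2 * √b * Real.cos θ)
            (jacobiSzegoPolynomial (fun _ => a) (fun _ => b) (n + 1)) * Real.sin θ)
          - b * (eval (a + 2 * √b * Real.cos θ)
            (jacobiSzegoPolynomial (fun _ => a) (fun _ => b) n) * Real.sin θ) := by ring
      _ = 2 * √b * Real.cos θ * (√b ^ (n + 1) * Real.sin ((n + 2) * θ))
          - √b ^ 2 * (√b ^ n * Real.sin ((n + 1) * θ)) := by rw [h0, h1, ← h3]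
      _ = _ := by linear_combination -√b ^ (n + 2) * h2

theorem integral_sin_mul_sin {n : ℕ} (hn : n ≠ 0) :
    ∫ θ in (0)..Real.pi, Real.sin ((n + 1) * θ) * Real.sin θ = 0 := by
  have hn' : (n : ℝ) ≠ 0 := Nat.cast_ne_zero.mpr hn
  have hn2 : (n : ℝ) + 2 ≠ 0 := by positivity
  have hd (k : ℝ) (hk : k ≠ 0) (θ : ℝ) :
      HasDerivAt (fun θ => Real.sin (k * θ) / (2 * k)) (Real.cos (k * θ) / 2) θ := by
    convert! (((hasDerivAt_id θ).const_mul k).sin.div_const (2 * k)) using 1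
    simp
    field_simp
  rw [intervalIntegral.integral_eq_sub_of_hasDerivAt
    (f := fun θ => Real.sin (n * θ) / (2 * n) - Real.sin ((n + 2) * θ) / (2 * (n + 2)))]
  · have h2 := Real.sin_nat_mul_pi (n + 2)
    push_cast at h2
    simp [Real.sin_nat_mul_pi, h2]
  · intro θ _
    convert! (hd n hn' θ).sub (hd (n + 2) hn2 θ) using 1
    rw [show (n : ℝ) * θ = (n + 1) * θ - θ by ring,
        show ((n : ℝ) + 2) * θ = (n + 1) * θ + θ by ring, Real.cos_add, Real.cos_sub]
    ring
  · exact (Continuous.intervalIntegrable (by fun_prop) _ _)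

theorem integral_jacobiSzegoPolynomial_semicircleLaw {a b : ℝ} (hb : 0 ≤ b) {n : ℕ}
    (hn : n ≠ 0) :
    ∫ x, (jacobiSzegoPolynomial (fun _ => a) (fun _ => b) n).eval x ∂semicircleLaw a b = 0 := by
  rcases hb.eq_or_lt with rfl | hb'
  · rw [semicircleLaw, if_pos rfl, integral_dirac]
    obtain ⟨m, rfl⟩ := Nat.exists_eq_succ_of_ne_zero hn
    cases m <;> simp [jacobiSzegoPolynomial]
  · rw [integral_semicircleLaw hb' (by fun_prop)]
    simp_rw [sq (Real.sin _), ← mul_assoc, eval_jacobiSzegoPolynomial_const_mul_sin hb, mul_assoc]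
    rw [intervalIntegral.integral_const_mul, integral_sin_mul_sin hn]
    simp

open Topology in
/-- The Cauchy transform of the semicircle law, in the coordinate that uniformizes it. -/
theorem cauchyTransform_semicircleLaw {a b : ℝ} (hb : 0 ≤ b) :
    ∀ᶠ w : ℂ in 𝓝[≠] 0, cauchyTransform (semicircleLaw a b) (a + b * w + 1 / w) = w := by
  have := isProbabilityMeasure_semicircleLaw (a := a) hb
  filter_upwards [cauchyTransform_of_integral_jacobiSzegoPolynomial
    (α := fun _ => a) (ω := fun _ => b) (M := max |a| |b|)
    (fun _ => le_max_left _ _) (fun _ => le_max_right _ _) (fun _ => rfl) (fun _ => rfl)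
    (ae_semicircleLaw hb) fun n hn => integral_jacobiSzegoPolynomial_semicircleLaw hb hn] with w hw
  simpa using hw.2

/-! ### Inversion near infinity -/

open Topology in
/-- Near infinity, `z = a + c w + 1 / w` has a solution `w` near `0`. -/
theorem eventually_exists_eq_add_one_div (a c : ℂ) {p : ℂ → Prop} (hp : ∀ᶠ w in 𝓝[≠] 0, p w) :
    ∀ᶠ z in cobounded ℂ, ∃ w, w ≠ 0 ∧ p w ∧ z = a + c * w + 1 / w := by
  rw [eventually_nhdsWithin_iff, Metric.eventually_nhds_iff] at hp
  obtain ⟨ε, hε, hp⟩ := hp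
  have hbig : ∀ᶠ z : ℂ in cobounded ℂ, ‖a‖ + 2 / ε < ‖z‖ :=
    (tendsto_norm_cobounded_atTop (E := ℂ)).eventually (eventually_gt_atTop _)
  filter_upwards [hbig] with z hz
  set u := z - a with hu
  have hu2 : 2 / ε < ‖u‖ := by
    have := norm_sub_norm_le z a
    linarith
  -- The equation is `c w² - u w + 1 = 0`. Its small root is written `2 / (u + s)`, which also
  -- covers `c = 0`; since `(u + s) + (u - s) = 2u`, one choice of sign makes `u + s` at least as
  -- large as `u`.
  obtain ⟨s, hs, hle⟩ : ∃ s : ℂ, s ^ 2 = u ^ 2 - 4 * c ∧ ‖u‖ ≤ ‖u + s‖ := by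
    obtain ⟨s, hs⟩ := IsAlgClosed.exists_pow_nat_eq (u ^ 2 - 4 * c) (n := 2) (by norm_num)
    by_cases h : ‖u‖ ≤ ‖u + s‖
    · exact ⟨s, hs, h⟩
    · refine ⟨-s, by rw [neg_sq, hs], ?_⟩
      have h1 : ‖(u + s) + (u + -s)‖ ≤ ‖u + s‖ + ‖u + -s‖ := norm_add_le _ _
      rw [show (u + s) + (u + -s) = 2 * u by ring, norm_mul, Complex.norm_ofNat] at h1
      linarith
  have hpos : 0 < 2 / ε := by positivity
  have hus : u + s ≠ 0 := norm_pos_iff.mp (hpos.trans (hu2.trans_le hle))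
  have hw0 : 2 / (u + s) ≠ 0 := div_ne_zero two_ne_zero hus
  refine ⟨2 / (u + s), hw0, hp ?_ hw0, ?_⟩
  · rw [dist_zero_right, norm_div, Complex.norm_ofNat, div_lt_comm₀ (norm_pos_iff.mpr hus) hε]
    exact hu2.trans_le hle
  · rw [show z = a + u by ring]
    field_simp
    linear_combination -hs

/-- Equal values at `w` and `v` force `w = v` or `b w v = 1`, and the latter is impossible for small
`w, v`. -/
theorem exists_injOn_of_eventually {F : ℂ → ℂ} {a b c : ℂ}
    (h : ∀ ε > 0, ∀ᶠ z in cobounded ℂ, ∃ w : ℂ, w ≠ 0 ∧ ‖w‖ < ε ∧ z = a + c * w + 1 / w ∧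
      F z = a + b * w + 1 / w) :
    ∃ R : ℝ, Set.InjOn F {z : ℂ | R < ‖z‖} := by
  have hε : 0 < 1 / (‖b‖ + 1) := by positivity
  obtain ⟨R, -, hR⟩ := hasBasis_cobounded_norm.eventually_iff.mp (h _ (lt_min one_pos hε))
  refine ⟨R, fun z hz y hy hzy => ?_⟩
  obtain ⟨w, hw0, hw, rfl, hFw⟩ := hR (show R ≤ ‖z‖ from le_of_lt hz)
  obtain ⟨v, hv0, hv, rfl, hFv⟩ := hR (show R ≤ ‖y‖ from le_of_lt hy)
  rw [hFw, hFv] at hzy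
  have h1 : (w - v) * (b * (w * v) - 1) = 0 := by
    field_simp at hzy
    linear_combination hzy
  rcases mul_eq_zero.mp h1 with h2 | h2
  · rw [sub_eq_zero.mp h2]
  · exfalso
    have h3 : ‖b‖ * (‖w‖ * ‖v‖) = 1 := by
      rw [← norm_mul, ← norm_mul, sub_eq_zero.mp h2, norm_one]
    have h4 : ‖w‖ * ‖v‖ ≤ 1 / (‖b‖ + 1) :=
      calc ‖w‖ * ‖v‖ ≤ 1 / (‖b‖ + 1) * 1 :=
            mul_le_mul (hw.le.trans (min_le_right _ _)) (hv.le.trans (min_le_left _ _))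
              (norm_nonneg _) hε.le
        _ = _ := mul_one _
    have h5 : ‖b‖ * (‖w‖ * ‖v‖) ≤ ‖b‖ * (1 / (‖b‖ + 1)) := by gcongr
    rw [h3, mul_one_div, le_div_iff₀ (by positivity)] at h5
    linarith

/-- Exhibiting any one right inverse suffices: the chosen one is then a genuine inverse, and its
germ at infinity is unique. -/
theorem IsInverseNearInfinity.voiculescuTransform {μ : Measure ℝ} {H : ℂ → ℂ}
    (h : IsInverseNearInfinity (reciprocalCauchyTransform μ) H) :
    IsInverseNearInfinity (reciprocalCauchyTransform μ)
        (fun y : ℂ => y + voiculescuTransform μ y) ∧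
      ∀ᶠ y in cobounded ℂ, voiculescuTransform μ y = H y - y := by
  have h1 : IsInverseNearInfinity (reciprocalCauchyTransform μ)
      (inverseNearInfinity (reciprocalCauchyTransform μ)) := Classical.epsilon_spec ⟨H, h⟩
  constructor
  · simpa [_root_.voiculescuTransform] using h1
  · filter_upwards [h1.eventuallyEq h] with y hy
    rw [_root_.voiculescuTransform, hy]

/-! ### Cauchy and Voiculescu transforms of free Meixner distributions -/

namespace IsFreeMeixner

variable {a b : ℝ} {μ : Measure ℝ}

open Topology in
theorem cauchyTransform_eq (h : IsFreeMeixner a b μ) :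
    ∀ᶠ w : ℂ in 𝓝[≠] 0, 1 + a * w + b * w ^ 2 ≠ 0 ∧
      cauchyTransform μ (a + (1 + b : ℝ) * w + 1 / w) = w / (1 + a * w + b * w ^ 2) := by
  have hJ := h.hasParameters
  have := hJ.isProbabilityMeasure
  set M := max |a| (max 1 |1 + b|) with hM
  have hα (n : ℕ) : |(fun n : ℕ => if n = 0 then (0 : ℝ) else a) n| ≤ M := by
    dsimp only
    split_ifs
    · rw [abs_zero]; positivity
    · exact le_max_left _ _
  have hω (n : ℕ) : |(fun n : ℕ => if n ≤ 1 then (1 : ℝ) else 1 + b) n| ≤ M := by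
    dsimp only
    split_ifs
    · rw [abs_one]; exact (le_max_left _ _).trans (le_max_right _ _)
    · exact (le_max_right _ _).trans (le_max_right _ _)
  filter_upwards [cauchyTransform_of_integral_jacobiSzegoPolynomial hα hω (a := a) (c := 1 + b)
    (fun n => by simp) (fun n => by simp) (hJ.ae_abs_le hα hω)
    fun n hn => hJ.integral_eval_jacobiSzegoPolynomial hn] with w hw
  simpa using hw

/-- The Voiculescu transform of a free Meixner distribution with `b ≥ 0`. -/
theorem voiculescuTransform_eq (h : IsFreeMeixner a b μ) (hb : 0 ≤ b) :
    IsInverseNearInfinity (reciprocalCauchyTransform μ)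
        (fun y : ℂ => y + voiculescuTransform μ y) ∧
      ∀ᶠ y in cobounded ℂ, voiculescuTransform μ y = cauchyTransform (semicircleLaw a b) y := by
  have hG := h.cauchyTransform_eq
  have hS := cauchyTransform_semicircleLaw (a := a) hb
  have hF {w : ℂ} (hw0 : w ≠ 0) (hw : cauchyTransform μ (a + (1 + b : ℝ) * w + 1 / w) =
      w / (1 + a * w + b * w ^ 2)) :
      reciprocalCauchyTransform μ (a + (1 + b : ℝ) * w + 1 / w) = a + b * w + 1 / w := by
    rw [reciprocalCauchyTransform, hw, one_div_div]
    field_simp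
    ring
  have hsmall (ε : ℝ) (hε : 0 < ε) : ∀ᶠ w : ℂ in nhdsWithin 0 {0}ᶜ, ‖w‖ < ε :=
    nhdsWithin_le_nhds (ContinuousAt.eventually_lt (by fun_prop) (by fun_prop) (by simpa))
  -- Injectivity uses the coordinate with `c = 1 + b`, natural for `G_μ`; the growth and the inverse
  -- property use `c = b`, natural for the semicircle law. Adding `w` passes from the second to the
  -- first.
  have hH : IsInverseNearInfinity (reciprocalCauchyTransform μ)
      (fun y => y + cauchyTransform (semicircleLaw a b) y) := by
    refine ⟨exists_injOn_of_eventually (a := a) (b := b) (c := (1 + b : ℝ)) fun ε hε => ?_, ?_, ?_⟩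
    · filter_upwards [eventually_exists_eq_add_one_div a (1 + b : ℝ) (hG.and (hsmall ε hε))]
      rintro z ⟨w, hw0, ⟨⟨-, hw⟩, hwε⟩, rfl⟩
      exact ⟨w, hw0, hwε, rfl, hF hw0 hw⟩
    · rw [← tendsto_norm_atTop_iff_cobounded]
      refine tendsto_atTop_mono' _ ?_ (tendsto_atTop_add_const_right (cobounded ℂ) (-1)
        tendsto_norm_cobounded_atTop)
      filter_upwards [eventually_exists_eq_add_one_div a b (hS.and (hsmall 1 one_pos))]
      rintro z ⟨w, hw0, ⟨hw, hw1⟩, rfl⟩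
      rw [hw]
      have := norm_sub_norm_le (a + b * w + 1 / w : ℂ) (-w)
      rw [norm_neg, sub_neg_eq_add] at this
      linarith
    · filter_upwards [eventually_exists_eq_add_one_div a b (hS.and hG)]
      rintro z ⟨w, hw0, ⟨hw, -, hw'⟩, rfl⟩
      rw [hw, show (a + b * w + 1 / w + w : ℂ) = a + (1 + b : ℝ) * w + 1 / w by
        push_cast; ring, hF hw0 hw']
  obtain ⟨h1, h2⟩ := hH.voiculescuTransform
  refine ⟨h1, h2.mono fun y hy => ?_⟩
  rw [hy, add_sub_cancel_left]

theorem cauchyTransform_eq_meixnerRational (h : IsFreeMeixner a b μ) :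
    ∀ᶠ z in cobounded ℂ,
      1 + (a : ℂ) * cauchyTransform (semicircleLaw a (1 + b)) z
          + (b : ℂ) * cauchyTransform (semicircleLaw a (1 + b)) z ^ 2 ≠ 0 ∧
      cauchyTransform μ z = meixnerRational a b (cauchyTransform (semicircleLaw a (1 + b)) z) := by
  have hb := h.neg_one_le
  filter_upwards [eventually_exists_eq_add_one_div a (1 + b : ℝ) (h.cauchyTransform_eq.and
    (cauchyTransform_semicircleLaw (a := a) (b := 1 + b) (by linarith)))]
  rintro z ⟨w, hw0, ⟨⟨h1, hG⟩, hS⟩, rfl⟩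
  rw [hS]
  exact ⟨h1, hG⟩

end IsFreeMeixner

/-! ### Existence, through the spectral measure of a Jacobi operator -/

section SpectralMeasure

open scoped CompactlySupported

variable {H : Type*} [NormedAddCommGroup H] [InnerProductSpace ℂ H] [CompleteSpace H]

theorem aeval_isSelfAdjoint {T : H →L[ℂ] H} (hT : IsSelfAdjoint T) (p : ℝ[X]) :
    IsSelfAdjoint (aeval T p) := by
  rw [← cfc_polynomial p T]
  exact cfc_predicate _ _

/-- The moments of a spectral measure of a bounded self-adjoint operator. -/
theorem exists_spectralMeasure {T : H →L[ℂ] H} (hT : IsSelfAdjoint T) (v : H) :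
    ∃ μ : Measure ℝ, IsFiniteMeasure μ ∧ ∀ p : ℝ[X], Integrable (fun x => p.eval x) μ ∧
      ∫ x, p.eval x ∂μ = (inner ℂ v (aeval T p v)).re := by
  -- The functional `f ↦ ⟨v, f(T) v⟩` is positive, so Riesz-Markov-Kakutani represents it by a
  -- measure on the compact spectrum.
  let Λ₀ : C_c(spectrum ℝ T, ℝ) →ₗ[ℝ] ℝ :=
    { toFun := fun f => (inner ℂ v (cfcHom hT (f : C(spectrum ℝ T, ℝ)) v)).re
      map_add' := fun f g => by
        have : ((f + g : C_c(spectrum ℝ T, ℝ)) : C(spectrum ℝ T, ℝ)) = f + g := rfl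
        rw [this]
        simp
      map_smul' := fun r f => by
        have : ((r • f : C_c(spectrum ℝ T, ℝ)) : C(spectrum ℝ T, ℝ)) = r • f := rfl
        rw [this]
        simp [inner_smul_right_eq_smul] }
  have hΛ (f : C_c(spectrum ℝ T, ℝ)) :
      Λ₀ f = (inner ℂ v (cfcHom hT (f : C(spectrum ℝ T, ℝ)) v)).re := rfl
  have hpos (f : C_c(spectrum ℝ T, ℝ)) (hf : 0 ≤ f) : 0 ≤ Λ₀ f := by
    have h1 := (cfcHom_nonneg_iff hT (f := (f : C(spectrum ℝ T, ℝ)))).mpr hf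
    rw [ContinuousLinearMap.nonneg_iff_isPositive] at h1
    exact h1.re_inner_nonneg_right v
  let Λ : C_c(spectrum ℝ T, ℝ) →ₚ[ℝ] ℝ := PositiveLinearMap.mk₀ Λ₀ hpos
  have : IsFiniteMeasure (RealRMK.rieszMeasure Λ) := inferInstance
  refine ⟨(RealRMK.rieszMeasure Λ).map Subtype.val, inferInstance, fun p => ⟨?_, ?_⟩⟩
  · rw [integrable_map_measure (by fun_prop) (by fun_prop)]
    exact Continuous.integrable_of_hasCompactSupport (by fun_prop)
      (HasCompactSupport.of_compactSpace _)
  · rw [integral_map (by fun_prop) (by fun_prop)]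
    have h1 := RealRMK.integral_rieszMeasure Λ
      (CompactlySupportedContinuousMap.continuousMapEquiv
        ⟨fun x : spectrum ℝ T => p.eval (x : ℝ), by fun_prop⟩)
    refine h1.trans ?_
    rw [← cfc_polynomial p T, cfc_apply _ T hT]
    rfl

end SpectralMeasure

theorem HilbertBasis.exists_shift {H : Type*} [NormedAddCommGroup H] [InnerProductSpace ℂ H]
    [CompleteSpace H] (e : HilbertBasis ℕ ℂ H) :
    ∃ S : H →L[ℂ] H, (∀ n, S (e n) = e (n + 1)) ∧ star S (e 0) = 0 ∧
      ∀ n, star S (e (n + 1)) = e n := by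
  have ho := e.orthonormal.comp Nat.succ Nat.succ_injective
  let S : H →L[ℂ] H :=
    (ho.orthogonalFamily.linearIsometry.comp e.repr.toLinearIsometry).toContinuousLinearMap
  have hS (n : ℕ) : S (e n) = e (n + 1) := by
    have h : e.repr (e n) = lp.single 2 n (1 : ℂ) := e.repr_self n
    simp [S, h]
  have hext (x y : H) (h : ∀ m, inner ℂ (e m) x = inner ℂ (e m) y) : x = y := by
    refine e.repr.injective (lp.ext (funext fun m => ?_))
    rw [e.repr_apply_apply, e.repr_apply_apply, h]
  have hon := orthonormal_iff_ite.mp e.orthonormal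
  refine ⟨S, hS, hext _ _ fun m => ?_, fun n => hext _ _ fun m => ?_⟩
  · rw [ContinuousLinearMap.star_eq_adjoint, ContinuousLinearMap.adjoint_inner_right, hS, hon]
    simp
  · rw [ContinuousLinearMap.star_eq_adjoint, ContinuousLinearMap.adjoint_inner_right, hS, hon, hon]
    simp

/-- A bounded self-adjoint Jacobi operator with the coefficients of a free Meixner distribution. -/
theorem HilbertBasis.exists_jacobiOperator {H : Type*} [NormedAddCommGroup H]
    [InnerProductSpace ℂ H] [CompleteSpace H] (e : HilbertBasis ℕ ℂ H) (a r : ℝ) :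
    ∃ T : H →L[ℂ] H, IsSelfAdjoint T ∧ T (e 0) = e 1 ∧
      T (e 1) = (r : ℂ) • e 2 + (a : ℂ) • e 1 + e 0 ∧
      ∀ n, T (e (n + 2)) = (r : ℂ) • e (n + 3) + (a : ℂ) • e (n + 2) + (r : ℂ) • e (n + 1) := by
  obtain ⟨S, hS, hS0, hS1⟩ := e.exists_shift
  have hS10 : star S (e 1) = e 0 := hS1 0
  -- The projection onto the line of `e 0`. It serves to change the weight between `e 0` and `e 1`
  -- from `r` to `1`, while `S * star S` puts `a` on the diagonal everywhere except at `e 0`.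
  set Q := 1 - S * star S with hQ
  have hQ0 : Q (e 0) = e 0 := by simp [hQ, hS0]
  have hQ1 (n : ℕ) : Q (e (n + 1)) = 0 := by simp [hQ, hS1, hS]
  have hQ10 : Q (e 1) = 0 := hQ1 0
  have hreal (x : ℝ) : IsSelfAdjoint (x : ℂ) := Complex.conj_ofReal x
  have hQs : star Q = Q := by simp [hQ]
  refine ⟨(r : ℂ) • (S + star S) + (a : ℂ) • (S * star S)
    + ((1 - r : ℝ) : ℂ) • (S * Q + Q * star S), ?_, ?_, ?_, fun n => ?_⟩
  · refine (((hreal r).smul (IsSelfAdjoint.add_star_self S)).add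
      ((hreal a).smul (IsSelfAdjoint.mul_star_self S))).add ((hreal _).smul ?_)
    rw [isSelfAdjoint_iff, star_add, star_mul, star_mul, star_star, hQs, add_comm]
  · simp [hQ0, hS0, hS]
    module
  · simp [hQ0, hQ10, hS10, hS]
    module
  · simp [hQ1, hS, hS1]
    module

/-- Applied to the first basis vector, the Jacobi-Szegő polynomials of a Jacobi operator give
multiples of the basis vectors. -/
theorem aeval_jacobiSzegoPolynomial_apply {H : Type*} [NormedAddCommGroup H]
    [InnerProductSpace ℂ H] [CompleteSpace H] {e : ℕ → H} {a b r : ℝ} (hr : 1 + b = r * r)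
    {T : H →L[ℂ] H} (hT0 : T (e 0) = e 1)
    (hT1 : T (e 1) = (r : ℂ) • e 2 + (a : ℂ) • e 1 + e 0)
    (hT2 : ∀ n, T (e (n + 2)) = (r : ℂ) • e (n + 3) + (a : ℂ) • e (n + 2) + (r : ℂ) • e (n + 1))
    (n : ℕ) :
    aeval T (jacobiSzegoPolynomial (fun n => if n = 0 then 0 else a)
      (fun n => if n ≤ 1 then 1 else 1 + b) n) (e 0) = (r : ℂ) ^ (n - 1) • e n := by
  have hC (x : ℝ) (v : H) : (algebraMap ℝ (H →L[ℂ] H) x) v = (x : ℂ) • v := by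
    rw [Algebra.algebraMap_eq_smul_one]
    rfl
  have hr' : (1 + b : ℂ) = r * r := mod_cast hr
  induction n using Nat.twoStepInduction with
  | zero => simp [jacobiSzegoPolynomial]
  | one => simp [jacobiSzegoPolynomial, hT0]
  | more n h0 h1 =>
    rw [jacobiSzegoPolynomial_add_two]
    simp only [map_sub, map_mul, aeval_X, aeval_C, sub_apply,
      mul_apply_eq_comp, h0, h1, map_smul, hC]
    -- `P_2` is separate: there `ω 1 = 1`, and the truncated exponent `n - 1` is `0` for both `n =
    -- 0` and `n = 1`.
    rcases n with _ | n
    · simp [hT1]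
      abel
    · simp [hT2, hr', pow_succ]
      module

/-- Free Meixner distributions exist for all parameters `a` and `b ≥ -1`. -/
theorem exists_isFreeMeixner (a : ℝ) {b : ℝ} (hb : -1 ≤ b) :
    ∃ η : Measure ℝ, IsFreeMeixner a b η := by
  let e : HilbertBasis ℕ ℂ (lp (fun _ : ℕ => ℂ) 2) := HilbertBasis.ofRepr (.refl ℂ _)
  obtain ⟨T, hT, hT0, hT1, hT2⟩ := e.exists_jacobiOperator a √(1 + b)
  have hr : 1 + b = √(1 + b) * √(1 + b) := (Real.mul_self_sqrt (by linarith)).symm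
  have hPe := aeval_jacobiSzegoPolynomial_apply hr hT0 hT1 hT2
  obtain ⟨η, hη, hint⟩ := exists_spectralMeasure hT (e 0)
  refine ⟨η, hb, ⟨?_⟩, fun n => ?_, fun m n hmn => ?_⟩
  · have h1 := (hint 1).2
    simp only [eval_one, integral_const, smul_eq_mul, mul_one, map_one,
      one_apply_eq_self, inner_self_eq_norm_sq_to_K, e.orthonormal.1] at h1
    simpa [measureReal_def, ENNReal.toReal_eq_one_iff] using h1
  · simpa using (hint (X ^ n)).1
  · have h1 := (hint (jacobiSzegoPolynomial (fun n => if n = 0 then 0 else a)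
      (fun n => if n ≤ 1 then 1 else 1 + b) m * jacobiSzegoPolynomial
      (fun n => if n = 0 then 0 else a) (fun n => if n ≤ 1 then 1 else 1 + b) n)).2
    simp only [eval_mul] at h1
    -- Self-adjointness moves `P_m(T)` to the left factor, leaving the inner product of multiples of
    -- `e m` and `e n`. These multiples may vanish (when `b = -1`), which does no harm.
    rw [h1, map_mul, mul_apply_eq_comp, ← (aeval_isSelfAdjoint hT _).adjoint_eq,
      ContinuousLinearMap.adjoint_inner_right, hPe, hPe]
    simp [inner_smul_left, inner_smul_right, e.orthonormal.2 hmn]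

theorem mainTheorem3 (a b : ℝ) (μ : Measure ℝ) (hμ : IsFreeMeixner a b μ) :
    (0 ≤ b →
      IsInverseNearInfinity (reciprocalCauchyTransform μ)
        (fun y : ℂ => y + voiculescuTransform μ y) ∧
      ∀ᶠ y in cobounded ℂ, voiculescuTransform μ y = cauchyTransform (semicircleLaw a b) y) ∧
    (-1 ≤ b → b < 0 →
      (∃ η : Measure ℝ, IsFreeMeixner a (1 + b) η) ∧
      ∀ η : Measure ℝ, IsFreeMeixner a (1 + b) η →
        IsInverseNearInfinity (reciprocalCauchyTransform η)
          (fun z : ℂ => z + voiculescuTransform η z) ∧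
        ∀ᶠ z in cobounded ℂ,
          voiculescuTransform η z = cauchyTransform (semicircleLaw a (1 + b)) z ∧
          1 + (a : ℂ) * voiculescuTransform η z + (b : ℂ) * voiculescuTransform η z ^ 2 ≠ 0 ∧
          cauchyTransform μ z = meixnerRational a b (voiculescuTransform η z)) := by
  refine ⟨hμ.voiculescuTransform_eq, fun hb _ => ⟨exists_isFreeMeixner a (by linarith),
    fun η hη => ?_⟩⟩
  obtain ⟨h1, h2⟩ := hη.voiculescuTransform_eq (by linarith)
  refine ⟨h1, ?_⟩
  filter_upwards [h2, hμ.cauchyTransform_eq_meixnerRational] with z hz hz'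
  rw [hz]
  exact ⟨rfl, hz'⟩
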